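/- All structures are in an at most countable signature whose only function symbols are constants. A structure is called $\aleph_0$-categorical if it is finite or is a countable model of an $\aleph_0$-categorical theory. $\mathrm{Aut}(\mathfrak M)$, $\mathrm{Emb}(\mathfrak M)$ and $\mathrm{End}(\mathfrak M)$ denote the automorphism group, the monoid of self-embeddings (isomorphisms onto a substructure) and the monoid of endomorphisms of $\mathfrak M$, with the topology of pointwise convergence ($M$ discrete). The orbit of $m\in M$ under a set $\Sigma$ of maps $M\to M$ is $\{\sigma(m)\mid\sigma\in\Sigma\}$. The basic sets of $\mathfrak M$ are the universe $M$, the diagonal of $M^2$, the interpretations of the relation symbols and the graphs of the interpretations of the function symbols (for a constant symbol, the singleton of its value). Definability is without parameters. An interpretation of $\mathfrak B$ in $\mathfrak A$ is a surjection $i:U\to B$ with $U\subseteq A^n$ for some $n$, such that the inverse images under $i$ of all basic sets of $\mathfrak B$ are definable in $\mathfrak A$; it is existential if all these inverse images are definable in $\mathfrak A$ by existential formulas. **Theorem.** Let $\mathfrak A$ be an $\aleph_0$-categorical structure with at least two elements, and let $\mathfrak B$ be a structure. Then the following are equivalent: 1. $\mathfrak B$ is existentially interpretable in $\mathfrak A$,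 i.e. there is an existential interpretation of $\mathfrak B$ in $\mathfrak A$; 2. there is a continuous monoid homomorphism $f:\mathrm{Emb}(\mathfrak A)\to\mathrm{End}(\mathfrak B)$ such that $B$ is covered by finitely many orbits under the image of $f$; 3. there is a continuous monoid homomorphism $f:\mathrm{Emb}(\mathfrak A)\to\mathrm{End}(\mathfrak B)$ such that $B$ is covered by finitely many orbits under $f[\mathrm{Aut}(\mathfrak A)]$. Moreover, for every continuous monoid homomorphism $f:\mathrm{Emb}(\mathfrak A)\to\mathrm{End}(\mathfrak B)$, $B$ is covered by finitely many orbits under the image of $f$ if and only if it is covered by finitely many orbits under $f[\mathrm{Aut}(\mathfrak A)]$. -/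

import Mathlib

open FirstOrder

universe u v w u' v' w'

namespace AlephZeroInterp

/-! ### Monoids of self-embeddings and of endomorphisms -/

section Monoids

variable {L : FirstOrder.Language.{u, v}} {M : Type w} [L.Structure M]

/-- `End(M)`, with composition of maps as multiplication. -/
instance instMonoidHom : Monoid (M →[L] M) where
  mul f g := f.comp g
  one := FirstOrder.Language.Hom.id L M
  mul_assoc _ _ _ := rfl
  one_mul _ := rfl
  mul_one _ := rfl

/-- `Emb(M)`, with composition of maps as multiplication. -/
instance instMonoidEmbedding : Monoid (M ↪[L] M) where
  mul f g := f.comp g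
  one := FirstOrder.Language.Embedding.refl L M
  mul_assoc _ _ _ := rfl
  one_mul _ := rfl
  mul_one _ := rfl

/-- The topology of pointwise convergence on `End(M)`, where `M` is discrete. -/
instance instTopologicalSpaceHom : TopologicalSpace (M →[L] M) :=
  TopologicalSpace.induced (fun σ : M →[L] M => (σ : M → M))
    (@Pi.topologicalSpace M (fun _ => M) (fun _ => ⊥))

/-- The topology of pointwise convergence on `Emb(M)`, where `M` is discrete. -/
instance instTopologicalSpaceEmbedding : TopologicalSpace (M ↪[L] M) :=
  TopologicalSpace.induced (fun σ : M ↪[L] M => (σ : M → M))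
    (@Pi.topologicalSpace M (fun _ => M) (fun _ => ⊥))

variable (L M) in
/-- `Aut(M)` as a subset of `Emb(M)`. -/
def autSet : Set (M ↪[L] M) :=
  Set.range fun α : M ≃[L] M => α.toEmbedding

/-- The orbit of `m` under a set of endomorphisms. -/
def orbit (S : Set (M →[L] M)) (m : M) : Set M :=
  {x | ∃ σ ∈ S, σ m = x}

/-- `M` is the union of the orbits of finitely many elements under `S`. -/
def CoveredByFinitelyManyOrbits (S : Set (M →[L] M)) : Prop :=
  ∃ F : Set M, F.Finite ∧ ⋃ m ∈ F, orbit S m = Set.univ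

end Monoids

/-! ### Signatures and `ℵ₀`-categorical structures -/

/-- The signature is at most countable, and all its function symbols are constants. -/
def CountableWithoutFunctions (L : FirstOrder.Language.{u, v}) : Prop :=
  Countable L.Symbols ∧ ∀ n : ℕ, IsEmpty (L.Functions (n + 1))

/-- A structure is called `ℵ₀`-categorical if it is finite or a countable model of an
`ℵ₀`-categorical theory. -/
def IsAlephZeroCategorical (L : FirstOrder.Language.{u, v}) (M : Type w) [L.Structure M] : Prop :=
  Finite M ∨
    (Countable M ∧ ∃ T : L.Theory, M ⊨ T ∧ Cardinal.Categorical.{u, v, w} Cardinal.aleph0 T)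

/-! ### Interpretations -/

/-- Definability without parameters by an existential formula. -/
def ExistentiallyDefinable (L : FirstOrder.Language.{u, v}) {M : Type w} [L.Structure M] {α : Type}
    (X : Set (α → M)) : Prop :=
  ∃ φ : L.Formula α, φ.IsExistential ∧ X = {x | φ.Realize x}

/-- The basic sets of a structure: the universe, the diagonal, the interpretations of the relation
symbols and the graphs of the interpretations of the function symbols (for a constant symbol, the
singleton of its value). -/
inductive IsBasicSet (L : FirstOrder.Language.{u, v}) (M : Type w) [L.Structure M] :
    ∀ {k : ℕ}, Set (Fin k → M) → Prop
  | univ : IsBasicSet L M (Set.univ : Set (Fin 1 → M))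
  | diagonal : IsBasicSet L M {x : Fin 2 → M | x 0 = x 1}
  | relation {k : ℕ} (R : L.Relations k) :
      IsBasicSet L M {x : Fin k → M | FirstOrder.Language.Structure.RelMap R x}
  | graph {k : ℕ} (g : L.Functions k) :
      IsBasicSet L M {x : Fin (k + 1) → M |
        FirstOrder.Language.Structure.funMap g (fun j => x j.castSucc) = x (Fin.last k)}

/-- The inverse image of `X ⊆ B ^ k` under a partial map `i` from `A ^ n` to `B` with domain `U`,
as a subset of `(A ^ n) ^ k = A ^ (k × n)`. -/
def tuplePreimage {A : Type w} {B : Type w'} {n : ℕ} {U : Set (Fin n → A)} (i : U → B) {k : ℕ}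
    (X : Set (Fin k → B)) : Set (Fin k × Fin n → A) :=
  {x | ∃ h : ∀ j, (fun m => x (j, m)) ∈ U, (fun j => i ⟨fun m => x (j, m), h j⟩) ∈ X}

/-- An interpretation of the `L'`-structure `B` in the `L`-structure `A`: a surjection from a
subset of some finite power of `A` onto `B` such that the inverse images of the basic sets of `B`
are definable in `A` without parameters. -/
structure Interpretation (L : FirstOrder.Language.{u, v}) (A : Type w) [L.Structure A]
    (L' : FirstOrder.Language.{u', v'}) (B : Type w') [L'.Structure B] where
  dim : ℕ
  domain : Set (Fin dim → A)
  toFun : domain → B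
  surjective : Function.Surjective toFun
  definable : ∀ {k : ℕ} (X : Set (Fin k → B)), IsBasicSet L' B X →
    (∅ : Set A).Definable L (tuplePreimage toFun X)

/-- An interpretation is existential if the inverse images of the basic sets are existentially
definable. -/
def Interpretation.IsExistential {L : FirstOrder.Language.{u, v}} {A : Type w} [L.Structure A]
    {L' : FirstOrder.Language.{u', v'}} {B : Type w'} [L'.Structure B] (i : Interpretation L A L' B) : Prop :=
  ∀ {k : ℕ} (X : Set (Fin k → B)), IsBasicSet L' B X →
    ExistentiallyDefinable L (tuplePreimage i.toFun X)

/-- `B` is existentially interpretable in `A`. -/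
def ExistentiallyInterpretable (L : FirstOrder.Language.{u, v}) (A : Type w) [L.Structure A]
    (L' : FirstOrder.Language.{u', v'}) (B : Type w') [L'.Structure B] : Prop :=
  ∃ i : Interpretation L A L' B, i.IsExistential

end AlephZeroInterp

/-!
The hypothesis on `A` enters only through the theorem of Ryll-Nardzewski, Engeler and Svenonius:
`Aut(A)` has finitely many orbits on each `A ^ n` (`IsAlephZeroCategorical.isOligomorphic`). For
infinite `A`, compactness and categoricity show that a family of `∅`-definable sets with the finite
intersection property has a common point in `A` itself (`exists_mem_of_finite_inter`). By a Baire
category argument isolated tuples are therefore dense, so `A` contains an elementary submodel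
consisting of isolated tuples; by categoricity it is isomorphic to `A`, and all tuples of `A` are
isolated. Compactness then leaves finitely many types, and back-and-forth turns equality of types
into conjugacy.

In an oligomorphic structure, trees of finite sequences are finitely branching modulo `Aut(A)`, so
König's lemma applies to them (`IsOligomorphic.exists_branch`). It has two consequences.

* If every finite part of `A` over a tuple `a` can be copied over `b`, then some self-embedding
  takes `a` to `b`. Hence relations invariant under `Emb(A)` are existentially definable
  (`IsOligomorphic.existentiallyDefinable`).
* For a continuous homomorphism `f : Emb(A) → End(B)` and a point `b`, there is one finite tuple `s`
  such that `σ s` determines `f σ b` for all `σ` at once (`IsOligomorphic.exists_uniform`).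

An existential interpretation `i` gives the homomorphism `f σ (i u) = i (σ u)`, whose restriction to
`Aut(A)` has finitely many orbits because `Aut(A)` has finitely many orbits on the domain of `i`.
Conversely, if the orbits of finitely many `b` cover `B`, the assignment `σ s ↦ f σ b` is well
defined and equivariant; the preimages of basic sets are invariant under `Emb(A)`, hence
existentially definable. Coding the choice of `b` by an equality pattern needs two elements of `A`.
Finally, the `Emb(A)`-orbit of `s` consists of finitely many `Aut(A)`-orbits, so the two finiteness
conditions on `f` are equivalent.
-/

namespace AlephZeroInterp

open FirstOrder.Language Set

/-! ### Isolated types -/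

section Isolated

variable (L : FirstOrder.Language.{u, v}) {M : Type w} [L.Structure M]

/-- The set `S` is an atom of the Boolean algebra of `∅`-definable sets and contains `x`; in other
words, a formula defining `S` isolates the complete type of `x`. -/
structure Isolates {α : Type*} (S : Set (α → M)) (x : α → M) : Prop where
  definable : (∅ : Set M).Definable L S
  mem : x ∈ S
  subset : ∀ S' : Set (α → M), (∅ : Set M).Definable L S' → x ∈ S' → S ⊆ S'

/-- The complete type of the tuple `x` is isolated. -/
def IsIsolated {α : Type*} (x : α → M) : Prop := ∃ S : Set (α → M), Isolates L S x

/-- The tuples `x` and `y` have the same complete type. -/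
def SameType {α : Type*} (x y : α → M) : Prop :=
  ∀ S : Set (α → M), (∅ : Set M).Definable L S → (x ∈ S ↔ y ∈ S)

variable {L}

theorem Isolates.sameType {α : Type*} {S : Set (α → M)} {x y : α → M} (h : Isolates L S x)
    (hy : y ∈ S) : SameType L x y := by
  intro S' hS'
  refine ⟨fun hx => h.subset S' hS' hx hy, fun hyS => ?_⟩
  by_contra hx
  exact h.subset S'ᶜ hS'.compl hx hy hyS

theorem Isolates.of_mem {α : Type*} {S : Set (α → M)} {x y : α → M} (h : Isolates L S x)
    (hy : y ∈ S) : Isolates L S y :=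
  ⟨h.definable, hy, fun S' hS' hyS' => h.subset S' hS' ((h.sameType hy S' hS').2 hyS')⟩

theorem SameType.symm {α : Type*} {x y : α → M} (h : SameType L x y) : SameType L y x :=
  fun S hS => (h S hS).symm

theorem SameType.comp {α β : Type*} {x y : α → M} (h : SameType L x y) (g : β → α) :
    SameType L (x ∘ g) (y ∘ g) :=
  fun _ hS => h _ (hS.preimage_comp g)

theorem SameType.realize_iff {α : Type*} {x y : α → M} (h : SameType L x y) (φ : L.Formula α) :
    φ.Realize x ↔ φ.Realize y :=
  h {z | φ.Realize z} (empty_definable_iff.2 ⟨φ, rfl⟩)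

theorem IsIsolated.comp {α β : Type*} [Finite α] [Finite β] {x : α → M} (h : IsIsolated L x)
    (g : β → α) : IsIsolated L (x ∘ g) := by
  obtain ⟨S, hS⟩ := h
  refine ⟨(fun z : α → M => z ∘ g) '' S, hS.definable.image_comp g, ⟨x, hS.mem, rfl⟩, ?_⟩
  rintro S' hS' hx _ ⟨z, hz, rfl⟩
  exact hS.subset _ (hS'.preimage_comp g) hx hz

/-- An elementary embedding reflects isolation of types. -/
theorem IsIsolated.of_elementaryEmbedding {N : Type*} [L.Structure N] (j : M ↪ₑ[L] N) {α : Type*}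
    {x : α → M} (h : IsIsolated L (j ∘ x)) : IsIsolated L x := by
  obtain ⟨S, hS, hx, hmin⟩ := h
  obtain ⟨φ, rfl⟩ := empty_definable_iff.1 hS
  refine ⟨{z | φ.Realize z}, empty_definable_iff.2 ⟨φ, rfl⟩, (j.map_formula φ x).1 hx, ?_⟩
  intro S' hS' hxS'
  obtain ⟨ψ, rfl⟩ := empty_definable_iff.1 hS'
  intro z hz
  exact (j.map_formula ψ z).1 (hmin {z | ψ.Realize z} (empty_definable_iff.2 ⟨ψ, rfl⟩)
    ((j.map_formula ψ x).2 hxS') ((j.map_formula φ z).2 hz))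

theorem isIsolated_of_isEmpty {α : Type*} [IsEmpty α] (x : α → M) : IsIsolated L x :=
  ⟨univ, definable_univ, mem_univ _, fun _ _ hx z _ => Subsingleton.elim x z ▸ hx⟩

end Isolated

/-! ### Countable models of categorical theories -/

section Categorical

variable {L : FirstOrder.Language.{u, v}} {A : Type w} [L.Structure A]

theorem categorical_iso {T : L.Theory} (hT : Cardinal.Categorical.{u, v, w} Cardinal.aleph0 T)
    [A ⊨ T] [Countable A] [Infinite A] (N : Type w) [L.Structure N] [Countable N]
    (h : A ≅[L] N) : Nonempty (A ≃[L] N) := by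
  have : Infinite N := h.infinite
  have : N ⊨ T := h.theory_model
  exact hT (Theory.ModelType.of T A) (Theory.ModelType.of T N)
    (Cardinal.mk_eq_aleph0 A) (Cardinal.mk_eq_aleph0 N)

theorem elementarilyEquivalent_of_model_completeTheory {N : Type*} [L.Structure N]
    (h : N ⊨ L.completeTheory A) : A ≅[L] N := by
  refine elementarilyEquivalent_iff.2 fun φ => ⟨fun hφ => h.realize_of_mem φ hφ, fun hφ => ?_⟩
  by_contra hA
  exact (h.realize_of_mem φ.not hA : ¬ N ⊨ φ) hφ

theorem infinite_of_model_onTheory_completeTheory [Infinite A] {L₁ : FirstOrder.Language}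
    (l : L →ᴸ L₁) (N : Type*) [L₁.Structure N] (h : N ⊨ l.onTheory (L.completeTheory A)) :
    Infinite N := by
  let _ : L.Structure N := l.reduct N
  have : l.IsExpansionOn N := LHom.isExpansionOn_reduct _ _
  exact (elementarilyEquivalent_of_model_completeTheory ((LHom.onTheory_model l _).1 h)).infinite

/-- A countable model of an `ℵ₀`-categorical theory realizes every finitely satisfiable set of
formulas in finitely many variables, because some countable model does so and all of them are
isomorphic. -/
theorem exists_mem_of_finite_inter [Countable L.Symbols] {T : L.Theory}
    (hT : Cardinal.Categorical.{u, v, w} Cardinal.aleph0 T)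
    [A ⊨ T] [Countable A] [Infinite A] {n : ℕ} (C : Set (Set (Fin n → A)))
    (hdef : ∀ S ∈ C, (∅ : Set A).Definable L S)
    (hfin : ∀ C₀ ⊆ C, C₀.Finite → ∃ x, ∀ S ∈ C₀, x ∈ S) : ∃ x, ∀ S ∈ C, x ∈ S := by
  classical
  -- The `n` variables become new constants, so that the formulas defining members of `C` become
  -- sentences, to be added to the complete theory of `A`.
  let Γ : Set (L.Formula (Fin n)) := {φ | {x : Fin n → A | φ.Realize x} ∈ C}
  let T₁ : L[[Fin n]].Theory :=
    (L.lhomWithConstants (Fin n)).onTheory (L.completeTheory A) ∪ Formula.equivSentence '' Γ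
  have hsat : T₁.IsSatisfiable := by
    rw [Theory.isSatisfiable_iff_isFinitelySatisfiable]
    intro T₀ hT₀
    obtain ⟨x, hx⟩ := hfin ((fun φ : L.Formula (Fin n) => {x : Fin n → A | φ.Realize x}) ''
        (Γ ∩ Formula.equivSentence ⁻¹' (T₀ : Set (L[[Fin n]].Sentence))))
      (by rintro _ ⟨φ, hφ, rfl⟩; exact hφ.1)
      (((T₀.finite_toSet.preimage Formula.equivSentence.injective.injOn).inter_of_right _).image _)
    let _ : (constantsOn (Fin n)).Structure A := constantsOn.structure x
    have : A ⊨ (T₀ : L[[Fin n]].Theory) := by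
      refine ⟨fun φ hφ => ?_⟩
      rcases hT₀ hφ with h | ⟨ψ, hψ, rfl⟩
      · exact ((LHom.onTheory_model (M := A) (L.lhomWithConstants (Fin n))
          (L.completeTheory A)).2 inferInstance).realize_of_mem φ h
      · exact (Formula.realize_equivSentence A ψ).2 (hx _ ⟨ψ, ⟨hψ, hφ⟩, rfl⟩)
    exact Theory.Model.isSatisfiable A
  have hred : ∀ (N : Type max u v) [L[[Fin n]].Structure N] [N ⊨ T₁] [Nonempty N], Infinite N := by
    intro N _ hN _
    exact infinite_of_model_onTheory_completeTheory (A := A) (L.lhomWithConstants (Fin n)) N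
      (hN.mono subset_union_left)
  obtain ⟨N, hN⟩ := Theory.exists_model_card_eq (T := T₁) ⟨hsat.some, hred _⟩
    Cardinal.aleph0.{w} le_rfl (by
      rw [Cardinal.lift_aleph0, Cardinal.lift_le_aleph0]
      exact Cardinal.mk_le_aleph0_iff.2 inferInstance)
  have hNT : N ⊨ (L.lhomWithConstants (Fin n)).onTheory (L.completeTheory A) :=
    N.is_model.mono subset_union_left
  let _ : L.Structure N := (L.lhomWithConstants (Fin n)).reduct N
  have : (L.lhomWithConstants (Fin n)).IsExpansionOn N := LHom.isExpansionOn_reduct _ _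
  have : Countable N := Cardinal.mk_le_aleph0_iff.1 hN.le
  obtain ⟨e⟩ := categorical_iso hT N
    (elementarilyEquivalent_of_model_completeTheory ((LHom.onTheory_model _ _).1 hNT))
  refine ⟨fun i => e.symm (L.con i : N), fun S hS => ?_⟩
  obtain ⟨φ, rfl⟩ := empty_definable_iff.1 (hdef S hS)
  have h1 : (Formula.equivSentence φ).Realize N :=
    Theory.realize_sentence_of_mem T₁ (Or.inr ⟨φ, hS, rfl⟩)
  rw [Formula.realize_equivSentence] at h1
  exact (StrongHomClass.realize_formula e.symm φ).2 h1

end Categorical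

/-! ### Density of isolated types -/

section Density

variable {L : FirstOrder.Language.{u, v}} {A : Type w} [L.Structure A]

/-- Isolated tuples are dense: otherwise a decreasing sequence of nonempty definable sets could
avoid, one after the other, each of the countably many tuples of the model. -/
theorem exists_isIsolated_mem [Countable L.Symbols] {T : L.Theory}
    (hT : Cardinal.Categorical.{u, v, w} Cardinal.aleph0 T)
    [A ⊨ T] [Countable A] [Infinite A] {n : ℕ} {S : Set (Fin n → A)}
    (hS : (∅ : Set A).Definable L S) (hne : S.Nonempty) : ∃ x ∈ S, IsIsolated L x := by
  by_contra! hcon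
  have step : ∀ (D : {D : Set (Fin n → A) // (∅ : Set A).Definable L D ∧ D.Nonempty ∧ D ⊆ S})
      (t : Fin n → A), ∃ D' : {D : Set (Fin n → A) // (∅ : Set A).Definable L D ∧ D.Nonempty ∧
        D ⊆ S}, D'.1 ⊆ D.1 ∧ t ∉ D'.1 := by
    rintro ⟨D, hD, ⟨y, hy⟩, hDS⟩ t
    obtain ⟨S', hS', hyS', hsub⟩ : ∃ S' : Set (Fin n → A), (∅ : Set A).Definable L S' ∧ y ∈ S' ∧
        ¬ D ⊆ S' := by
      by_contra! h
      exact hcon y (hDS hy) ⟨D, hD, hy, h⟩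
    obtain ⟨z, hz, hzS'⟩ := not_subset.1 hsub
    by_cases ht : t ∈ S'
    · exact ⟨⟨D ∩ S'ᶜ, hD.inter hS'.compl, ⟨z, hz, hzS'⟩, inter_subset_left.trans hDS⟩,
        inter_subset_left, fun h => h.2 ht⟩
    · exact ⟨⟨D ∩ S', hD.inter hS', ⟨y, hy, hyS'⟩, inter_subset_left.trans hDS⟩,
        inter_subset_left, fun h => ht h.2⟩
  choose next hsub hnot using step
  obtain ⟨t, ht⟩ := exists_surjective_nat (Fin n → A)
  let D : ℕ → {D : Set (Fin n → A) // (∅ : Set A).Definable L D ∧ D.Nonempty ∧ D ⊆ S} :=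
    fun k => Nat.rec ⟨S, hS, hne, Subset.rfl⟩ (fun k p => next p (t k)) k
  have hanti : Antitone fun k => (D k).1 := antitone_nat_of_succ_le fun k => hsub (D k) (t k)
  obtain ⟨x, hx⟩ := exists_mem_of_finite_inter (L := L) hT (range fun k => (D k).1)
    (by rintro _ ⟨k, rfl⟩; exact (D k).2.1) (by
      intro C₀ hC₀ hfin
      obtain ⟨s, -, hs, rfl⟩ := hfin.exists_subset_finite_image_eq (image_univ ▸ hC₀)
      obtain ⟨m, hm⟩ := hs.bddAbove
      obtain ⟨x, hx⟩ := (D m).2.2.1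
      refine ⟨x, ?_⟩
      rintro _ ⟨k, hk, rfl⟩
      exact hanti (hm hk) hx)
  obtain ⟨k, rfl⟩ := ht x
  exact hnot (D k) (t k) (hx _ ⟨k + 1, rfl⟩)

/-- A definable set over an isolated tuple has an isolated point. -/
theorem IsIsolated.exists_snoc [Countable L.Symbols] {T : L.Theory}
    (hT : Cardinal.Categorical.{u, v, w} Cardinal.aleph0 T)
    [A ⊨ T] [Countable A] [Infinite A] {k : ℕ} {g : Fin k → A} (hg : IsIsolated L g)
    {D : Set (Fin (k + 1) → A)} (hD : (∅ : Set A).Definable L D)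
    (hne : ∃ x : A, (Fin.snoc g x : Fin (k + 1) → A) ∈ D) :
    ∃ x : A, (Fin.snoc g x : Fin (k + 1) → A) ∈ D ∧
      IsIsolated L (Fin.snoc g x : Fin (k + 1) → A) := by
  obtain ⟨S, hS⟩ := hg
  obtain ⟨x₀, hx₀⟩ := hne
  obtain ⟨z, ⟨hzD, hzS⟩, E, hE⟩ := exists_isIsolated_mem (L := L) hT
    (hD.inter (hS.definable.preimage_comp (Fin.castSucc : Fin k → Fin (k + 1))))
    ⟨Fin.snoc g x₀, hx₀, by
      simp only [mem_preimage]
      convert hS.mem using 1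
      ext i; simp⟩
  obtain ⟨z', hz'E, hz'⟩ := (hS.of_mem hzS).subset _
    (hE.definable.image_comp (Fin.castSucc : Fin k → Fin (k + 1))) ⟨z, hE.mem, rfl⟩ hS.mem
  have hsnoc : (Fin.snoc g (z' (Fin.last k)) : Fin (k + 1) → A) = z' := by
    rw [← hz']
    exact Fin.snoc_init_self z'
  refine ⟨z' (Fin.last k), ?_⟩
  rw [hsnoc]
  exact ⟨(hE.sameType hz'E D hD).1 hzD, E, hE.of_mem hz'E⟩

end Density

/-! ### The atomic elementary submodel -/

section Atomic

variable (L : FirstOrder.Language.{u, v}) {A : Type w} [L.Structure A]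

/-- All tuples of elements of `F` have isolated types. -/
def IsAtomicSet (F : Set A) : Prop :=
  ∀ (k : ℕ) (g : Fin k → A), (∀ i, g i ∈ F) → IsIsolated L g

variable {L}

theorem isAtomicSet_range {ι : Type*} [Finite ι] {g : ι → A} (hg : IsIsolated L g) :
    IsAtomicSet L (range g) := by
  intro k g' hg'
  choose h hh using hg'
  obtain rfl : g ∘ h = g' := funext hh
  exact hg.comp h

/-- A witness for a formula with parameters in a finite atomic set can be chosen so that the set
remains atomic. -/
theorem IsAtomicSet.exists_insert [Countable L.Symbols] {T : L.Theory}
    (hT : Cardinal.Categorical.{u, v, w} Cardinal.aleph0 T)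
    [A ⊨ T] [Countable A] [Infinite A] {F : Finset A} (hF : IsAtomicSet L (F : Set A)) {n : ℕ}
    {D : Set (Fin (n + 1) → A)} (hD : (∅ : Set A).Definable L D) {c : Fin n → A}
    (hc : ∀ i, c i ∈ F) (hne : ∃ x : A, (Fin.snoc c x : Fin (n + 1) → A) ∈ D) :
    ∃ x : A, (Fin.snoc c x : Fin (n + 1) → A) ∈ D ∧ IsAtomicSet L (insert x (F : Set A)) := by
  let g : Fin F.card → A := fun i => F.equivFin.symm i
  have hg : range g = F := by
    ext x
    simp only [mem_range, g]
    exact ⟨fun ⟨i, hi⟩ => hi ▸ (F.equivFin.symm i).2, fun hx => ⟨F.equivFin ⟨x, hx⟩, by simp⟩⟩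
  let h : Fin (n + 1) → Fin (F.card + 1) :=
    Fin.snoc (fun i => (F.equivFin ⟨c i, hc i⟩).castSucc) (Fin.last _)
  have hh : ∀ x : A,
      (Fin.snoc g x : Fin (F.card + 1) → A) ∘ h = (Fin.snoc c x : Fin (n + 1) → A) := by
    intro x
    ext i
    induction i using Fin.lastCases with
    | last => simp [h]
    | cast i => simp [h, g]
  obtain ⟨x, hxD, hx⟩ := (hF _ g fun i => hg ▸ mem_range_self i).exists_snoc hT
    (hD.preimage_comp h) (hne.imp fun x hx => by rwa [mem_preimage, hh])
  rw [mem_preimage, hh] at hxD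
  refine ⟨x, hxD, ?_⟩
  convert isAtomicSet_range hx using 1
  rw [Fin.range_snoc, hg]

theorem definable_realize_boundedFormula {n : ℕ} (φ : L.BoundedFormula Empty n) :
    (∅ : Set A).Definable L {z : Fin n → A | φ.Realize default z} := by
  refine empty_definable_iff.2 ⟨φ.toFormula.relabel (Sum.elim Empty.elim id), ?_⟩
  ext z
  simp only [mem_ofPred_eq, Formula.realize_relabel, BoundedFormula.realize_toFormula]
  exact iff_of_eq (congrArg₂ _ (Subsingleton.elim _ _) rfl)

/-- The model has a countable elementary submodel all of whose tuples have isolated types. It is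
the union of a generic chain of finite atomic sets, which meets the requirements of the
Tarski–Vaught test one by one. -/
theorem exists_atomic_elementarySubstructure [Countable L.Symbols] {T : L.Theory}
    (hT : Cardinal.Categorical.{u, v, w} Cardinal.aleph0 T)
    [A ⊨ T] [Countable A] [Infinite A] :
    ∃ N : L.ElementarySubstructure A, IsAtomicSet L (N : Set A) := by
  classical
  let P := {F : Finset A // IsAtomicSet L (F : Set A)}
  let ι := Σ n : ℕ, L.BoundedFormula Empty (n + 1) × (Fin n → A)
  have hcount : ∀ n, Countable (L.BoundedFormula Empty n) := fun n =>
    Function.Injective.countable (f := fun φ : L.BoundedFormula Empty n =>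
      (⟨n, φ⟩ : Σ n, L.BoundedFormula Empty n)) sigma_mk_injective
  have : Encodable ι := Encodable.ofCountable ι
  -- The first alternative makes the requirement cofinal when `c` lies in no larger atomic set.
  let 𝒟 : ι → Order.Cofinal P := fun ⟨n, φ, c⟩ =>
    { carrier := {F | (∀ F' : P, F ≤ F' → ¬ ∀ i, c i ∈ F'.1) ∨
        ∀ a, φ.Realize default (Fin.snoc c a : Fin (n + 1) → A) →
          ∃ b ∈ F.1, φ.Realize default (Fin.snoc c b : Fin (n + 1) → A)}
      isCofinal := by
        intro F
        by_cases h : ∃ F' : P, F ≤ F' ∧ ∀ i, c i ∈ F'.1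
        · obtain ⟨F', hFF', hc⟩ := h
          by_cases ha : ∃ a, φ.Realize default (Fin.snoc c a : Fin (n + 1) → A)
          · obtain ⟨x, hx, hins⟩ := F'.2.exists_insert hT (definable_realize_boundedFormula φ) hc ha
            refine ⟨⟨insert x F'.1, by simpa using hins⟩, Or.inr fun _ _ => ⟨x, by simp, hx⟩, ?_⟩
            exact hFF'.trans (Finset.subset_insert x F'.1)
          · exact ⟨F, Or.inr fun a h => (ha ⟨a, h⟩).elim, le_rfl⟩
        · exact ⟨F, Or.inl fun F' hF' hc => h ⟨F', hF', hc⟩, le_rfl⟩ }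
  let I := Order.idealOfCofinals
    (⟨∅, fun k g hg => by
      have : IsEmpty (Fin k) := ⟨fun i => by simpa using hg i⟩
      exact isIsolated_of_isEmpty g⟩ : P) 𝒟
  let N : Set A := {a | ∃ F ∈ I, a ∈ F.1}
  have hN : ∀ (k : ℕ) (g : Fin k → A), (∀ i, g i ∈ N) → ∃ F ∈ I, ∀ i, g i ∈ F.1 := by
    intro k g hg
    obtain ⟨G, hG, hgG⟩ := DirectedOn.exists_mem_subset_of_finset_subset_biUnion
      (f := fun F : P => (F.1 : Set A)) (c := (I : Set P)) I.nonempty I.directed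
      (s := Finset.univ.image g) (by
        intro a ha
        obtain ⟨i, rfl⟩ : ∃ i, g i = a := by simpa using ha
        obtain ⟨F, hF, hgF⟩ := hg i
        exact mem_biUnion hF hgF)
    exact ⟨G, hG, fun i => hgG (by simp)⟩
  have hTV : ∀ (n : ℕ) (φ : L.BoundedFormula Empty (n + 1)) (x : Fin n → A), (∀ i, x i ∈ N) →
      ∀ a, φ.Realize default (Fin.snoc x a : Fin (n + 1) → A) →
        ∃ b ∈ N, φ.Realize default (Fin.snoc x b : Fin (n + 1) → A) := by
    intro n φ x hx a ha
    obtain ⟨F, hF, hFI⟩ := Order.cofinal_meets_idealOfCofinals _ 𝒟 ⟨n, φ, x⟩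
    obtain ⟨G, hG, hxG⟩ := hN n x hx
    obtain ⟨H, hH, hFH, hGH⟩ := I.directed F hFI G hG
    rcases hF with h | h
    · exact (h H hFH fun i => hGH (hxG i)).elim
    · obtain ⟨b, hb, hφ⟩ := h a ha
      exact ⟨b, ⟨F, hFI, hb⟩, hφ⟩
  let S : L.Substructure A :=
    { carrier := N
      fun_mem := by
        intro n f x hx
        obtain ⟨b, hb, hφ⟩ := hTV n ((Term.func f fun i => Term.var (Sum.inr i.castSucc)).bdEqual
          (Term.var (Sum.inr (Fin.last n)))) x hx (Structure.funMap f x) (by simp)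
        simp at hφ
        exact hφ ▸ hb }
  refine ⟨S.toElementarySubstructure fun n φ x a ha => ?_, fun k g hg => ?_⟩
  · obtain ⟨b, hb, hφ⟩ := hTV n φ (fun i => x i) (fun i => (x i).2) a ha
    exact ⟨⟨b, hb⟩, hφ⟩
  · obtain ⟨F, -, hF⟩ := hN k g hg
    exact F.2 k g hF

/-- Every tuple of a countable model of an `ℵ₀`-categorical theory has an isolated type, since the
model is isomorphic to its atomic elementary submodel. -/
theorem isIsolated_of_categorical [Countable L.Symbols] {T : L.Theory}
    (hT : Cardinal.Categorical.{u, v, w} Cardinal.aleph0 T)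
    [A ⊨ T] [Countable A] [Infinite A] {k : ℕ} (x : Fin k → A) : IsIsolated L x := by
  obtain ⟨N, hN⟩ := exists_atomic_elementarySubstructure (L := L) (A := A) hT
  obtain ⟨e⟩ := categorical_iso hT N N.elementarilyEquivalent.symm
  exact IsIsolated.of_elementaryEmbedding (N.subtype.comp e.toElementaryEmbedding)
    (hN k _ fun i => (e (x i)).2)

end Atomic

/-! ### Finiteness of the number of orbits -/

section RyllNardzewski

variable {L : FirstOrder.Language.{u, v}} {A : Type w} [L.Structure A]

/-- There are only finitely many types of `n`-tuples: if no finite family of isolating sets covers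
`A ^ n`, then some tuple avoids all of them and its type is not isolated. -/
theorem exists_finite_sameType [Countable L.Symbols] {T : L.Theory}
    (hT : Cardinal.Categorical.{u, v, w} Cardinal.aleph0 T)
    [A ⊨ T] [Countable A] [Infinite A] (n : ℕ) :
    ∃ F : Set (Fin n → A), F.Finite ∧ ∀ x, ∃ t ∈ F, SameType L t x := by
  by_contra! hcon
  choose S hS using fun x : Fin n → A => isIsolated_of_categorical hT x
  obtain ⟨x, hx⟩ := exists_mem_of_finite_inter (L := L) hT (range fun t => (S t)ᶜ)
    (by rintro _ ⟨t, rfl⟩; exact (hS t).definable.compl) (by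
      intro C₀ hC₀ hfin
      obtain ⟨s, -, hs, rfl⟩ := hfin.exists_subset_finite_image_eq (image_univ ▸ hC₀)
      obtain ⟨x, hx⟩ := hcon s hs
      refine ⟨x, ?_⟩
      rintro _ ⟨t, ht, rfl⟩ hxt
      exact hx t ht ((hS t).sameType hxt))
  exact hx _ ⟨x, rfl⟩ (hS x).mem

variable (L) in
/-- The set of pairs `G` is a partial elementary map, as a binary relation. -/
def IsPartialElementary (G : Set (A × A)) : Prop :=
  ∀ (k : ℕ) (g : Fin k → A × A), (∀ i, g i ∈ G) →
    SameType L (fun i => (g i).1) (fun i => (g i).2)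

theorem isPartialElementary_range {ι : Type*} {a b : ι → A} (h : SameType L a b) :
    IsPartialElementary L (range fun i => (a i, b i)) := by
  intro k g hg
  choose i hi using hg
  convert h.comp i using 1 <;> · ext j; simp [← hi]

theorem IsPartialElementary.swap {G : Set (A × A)} (h : IsPartialElementary L G) :
    IsPartialElementary L (Prod.swap '' G) := by
  intro k g hg
  exact (h k (fun i => (g i).swap) fun i => by
    obtain ⟨p, hp, hpg⟩ := hg i
    rwa [← hpg, Prod.swap_swap]).symm

/-- The forth step: a formula isolating the type of the domain of `G` together with `x` has a
realization over the range of `G`. -/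
theorem IsPartialElementary.exists_insert (hiso : ∀ (k : ℕ) (x : Fin k → A), IsIsolated L x)
    {G : Finset (A × A)} (h : IsPartialElementary L (G : Set (A × A))) (x : A) :
    ∃ y, IsPartialElementary L (insert (x, y) (G : Set (A × A))) := by
  let g : Fin G.card → A × A := fun i => G.equivFin.symm i
  have hg : range g = G := by
    ext p
    simp only [mem_range, g]
    exact ⟨fun ⟨i, hi⟩ => hi ▸ (G.equivFin.symm i).2, fun hp => ⟨G.equivFin ⟨p, hp⟩, by simp⟩⟩
  obtain ⟨S, hS⟩ := hiso _ (Fin.snoc (fun i => (g i).1) x : Fin (G.card + 1) → A)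
  obtain ⟨z, hz, hzg⟩ := (h _ g (fun i => hg ▸ mem_range_self i) _
    (hS.definable.image_comp (Fin.castSucc : Fin G.card → Fin (G.card + 1)))).1
    ⟨_, hS.mem, by ext i; simp⟩
  have hz' : (Fin.snoc (fun i => (g i).2) (z (Fin.last _)) : Fin (G.card + 1) → A) = z := by
    rw [← hzg]
    exact Fin.snoc_init_self z
  refine ⟨z (Fin.last _), ?_⟩
  convert isPartialElementary_range (hS.sameType hz) using 1
  rw [← hg, ← Fin.range_snoc]
  congr 1
  ext i : 1
  induction i using Fin.lastCases with
  | last => simp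
  | cast i =>
    have hi : z i.castSucc = (g i).2 := congrFun hzg i
    simp [hi]

/-- The back step, which is the forth step for the converse relation. -/
theorem IsPartialElementary.exists_insert' (hiso : ∀ (k : ℕ) (x : Fin k → A), IsIsolated L x)
    {G : Finset (A × A)} (h : IsPartialElementary L (G : Set (A × A))) (y : A) :
    ∃ x, IsPartialElementary L (insert (x, y) (G : Set (A × A))) := by
  classical
  obtain ⟨x, hx⟩ := IsPartialElementary.exists_insert hiso (G := G.image Prod.swap)
    (by simpa using h.swap) y
  refine ⟨x, ?_⟩
  convert hx.swap using 1
  simp [image_insert_eq, image_image]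

/-- A total and surjective partial elementary map is an automorphism. -/
theorem IsPartialElementary.exists_equiv {G : Set (A × A)} (h : IsPartialElementary L G)
    (hdom : ∀ x, ∃ y, (x, y) ∈ G) (hcod : ∀ y, ∃ x, (x, y) ∈ G) :
    ∃ α : A ≃[L] A, ∀ p ∈ G, α p.1 = p.2 := by
  choose f hf using hdom
  let f' : A ↪ₑ[L] A :=
    { toFun := f
      map_formula' := fun n φ x =>
        ((h n (fun i => (x i, f (x i))) fun i => hf _).realize_iff φ).symm }
  have huniq : ∀ p ∈ G, f p.1 = p.2 := by
    intro p hp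
    have := (h 2 ![(p.1, f p.1), p] (by intro i; fin_cases i <;> simp [hf, hp])).realize_iff
      ((Term.var 0).equal (Term.var 1))
    simpa [Formula.realize_equal] using this
  have hsurj : Function.Surjective f := fun y => by
    obtain ⟨x, hx⟩ := hcod y
    exact ⟨x, huniq _ hx⟩
  exact ⟨{ Equiv.ofBijective f ⟨f'.injective, hsurj⟩ with
    map_fun' := fun F x => f'.map_fun F x
    map_rel' := fun R x => f'.map_rel R x }, huniq⟩

/-- Homogeneity, by back-and-forth: tuples of the same type are conjugate under `Aut(A)`. -/
theorem SameType.exists_equiv [Countable A] (hiso : ∀ (k : ℕ) (x : Fin k → A), IsIsolated L x)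
    {n : ℕ} {a b : Fin n → A} (hab : SameType L a b) : ∃ α : A ≃[L] A, α ∘ a = b := by
  classical
  let P := {G : Finset (A × A) // IsPartialElementary L (G : Set (A × A))}
  have : Encodable A := Encodable.ofCountable A
  let 𝒟 : A ⊕ A → Order.Cofinal P := Sum.elim
    (fun x => { carrier := {G | ∃ y, (x, y) ∈ G.1}
                isCofinal := fun G => by
                  obtain ⟨y, hy⟩ := G.2.exists_insert hiso x
                  exact ⟨⟨insert (x, y) G.1, by simpa using hy⟩, ⟨y, by simp⟩,
                    Finset.subset_insert _ G.1⟩ })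
    (fun y => { carrier := {G | ∃ x, (x, y) ∈ G.1}
                isCofinal := fun G => by
                  obtain ⟨x, hx⟩ := G.2.exists_insert' hiso y
                  exact ⟨⟨insert (x, y) G.1, by simpa using hx⟩, ⟨x, by simp⟩,
                    Finset.subset_insert _ G.1⟩ })
  let p : P := ⟨Finset.univ.image fun i => (a i, b i), by
    simpa using isPartialElementary_range hab⟩
  let I := Order.idealOfCofinals p 𝒟
  have hG : IsPartialElementary L {q : A × A | ∃ G ∈ I, q ∈ G.1} := by
    intro k g hg
    obtain ⟨G, -, hgG⟩ := DirectedOn.exists_mem_subset_of_finset_subset_biUnion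
      (f := fun F : P => (F.1 : Set (A × A))) (c := (I : Set P)) I.nonempty I.directed
      (s := Finset.univ.image g) (by
        intro a ha
        obtain ⟨i, rfl⟩ : ∃ i, g i = a := by simpa using ha
        obtain ⟨F, hF, hgF⟩ := hg i
        exact mem_biUnion hF hgF)
    exact G.2 k g fun i => hgG (by simp)
  obtain ⟨α, hα⟩ := hG.exists_equiv
    (fun x => by
      obtain ⟨G, ⟨y, hy⟩, hGI⟩ := Order.cofinal_meets_idealOfCofinals p 𝒟 (Sum.inl x)
      exact ⟨y, G, hGI, hy⟩)
    (fun y => by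
      obtain ⟨G, ⟨x, hx⟩, hGI⟩ := Order.cofinal_meets_idealOfCofinals p 𝒟 (Sum.inr y)
      exact ⟨x, G, hGI, hx⟩)
  refine ⟨α, funext fun i => ?_⟩
  exact hα (a i, b i)
    ⟨p, Order.mem_idealOfCofinals p 𝒟, Finset.mem_image_of_mem _ (Finset.mem_univ i)⟩

variable (L A) in
/-- `Aut(A)` has only finitely many orbits on every finite power of `A`. -/
def IsOligomorphic : Prop :=
  ∀ n : ℕ, ∃ F : Set (Fin n → A), F.Finite ∧ ∀ x, ∃ t ∈ F, ∃ α : A ≃[L] A, α ∘ t = x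

/-- The theorem of Ryll-Nardzewski, Engeler and Svenonius, in the direction used here. -/
theorem IsAlephZeroCategorical.isOligomorphic [Countable L.Symbols]
    (hA : IsAlephZeroCategorical L A) : IsOligomorphic L A := by
  intro n
  rcases finite_or_infinite A with _ | _
  · exact ⟨univ, finite_univ, fun x => ⟨x, mem_univ x, FirstOrder.Language.Equiv.refl L A, rfl⟩⟩
  · obtain ⟨_, T, _, hT⟩ := hA.resolve_left (not_finite_iff_infinite.2 inferInstance)
    obtain ⟨F, hF, h⟩ := exists_finite_sameType (L := L) (A := A) hT n
    exact ⟨F, hF, fun x => (h x).imp fun t ht =>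
      ⟨ht.1, ht.2.exists_equiv fun k x => isIsolated_of_categorical hT x⟩⟩

theorem IsOligomorphic.of_finite_index (hA : IsOligomorphic L A) (ι : Type*) [Finite ι] :
    ∃ F : Set (ι → A), F.Finite ∧ ∀ x, ∃ t ∈ F, ∃ α : A ≃[L] A, α ∘ t = x := by
  obtain ⟨n, ⟨e⟩⟩ := Finite.exists_equiv_fin ι
  obtain ⟨F, hF, h⟩ := hA n
  refine ⟨(· ∘ e) '' F, hF.image _, fun x => ?_⟩
  obtain ⟨t, ht, α, hα⟩ := h (x ∘ e.symm)
  refine ⟨_, ⟨t, ht, rfl⟩, α, ?_⟩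
  rw [← Function.comp_assoc, hα]
  simp [Function.comp_assoc]

end RyllNardzewski

/-! ### König's lemma modulo automorphisms -/

section Koenig

variable {L : FirstOrder.Language.{u, v}} {A : Type w} [L.Structure A]

/-- König's lemma modulo automorphisms: an `Aut(A)`-invariant tree of finite sequences in an
oligomorphic structure that has nodes of every length has an infinite branch, because its quotient
by `Aut(A)` is finitely branching. Here `P n c` says that the first `n` entries of `c` form a node
of the tree. -/
theorem IsOligomorphic.exists_branch (hA : IsOligomorphic L A) (P : ℕ → (ℕ → A) → Prop)
    (hanti : ∀ n c, P (n + 1) c → P n c)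
    (hlocal : ∀ n c c', (∀ i < n, c i = c' i) → P n c → P n c')
    (hinv : ∀ n c (α : A ≃[L] A), P n c → P n (α ∘ c))
    (hne : ∀ n, ∃ c, P n c) : ∃ e : ℕ → A, ∀ n, P n e := by
  -- `Good n c`: the first `n` entries of `c` extend to nodes of arbitrary length.
  let Good : ℕ → (ℕ → A) → Prop := fun n c => ∀ m, ∃ c', P m c' ∧ ∀ i < n, c' i = c i
  have hle : ∀ {m n c}, m ≤ n → P n c → P m c := fun {m n c} hmn h =>
    Nat.decreasingInduction (motive := fun k _ => P k c) (fun k _ => hanti k c) h hmn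
  have step : ∀ n c, Good n c → ∃ x, Good (n + 1) (Function.update c n x) := by
    intro n c hc
    choose c' hc' hc'c using hc
    obtain ⟨F, hF, hrep⟩ := hA (n + 1)
    choose t ht α hα using fun m => hrep fun i : Fin (n + 1) => c' m i
    have : Finite F := hF
    -- Infinitely many of the witnesses `c' m` have conjugate initial segments of length `n + 1`.
    obtain ⟨⟨t₀, ht₀⟩, hinf⟩ := Finite.exists_infinite_fiber fun m => (⟨t m, ht m⟩ : F)
    rw [Set.infinite_coe_iff] at hinf
    obtain ⟨m₀, hm₀⟩ := hinf.nonempty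
    refine ⟨c' m₀ n, fun m => ?_⟩
    obtain ⟨m₁, hm₁, hlt⟩ := hinf.exists_gt m
    have hm₀' : t m₀ = t₀ := congrArg Subtype.val hm₀
    have hm₁' : t m₁ = t₀ := congrArg Subtype.val hm₁
    refine ⟨((α m₀).comp (α m₁).symm) ∘ c' m₁, hinv _ _ _ (hle hlt.le (hc' m₁)), ?_⟩
    have heq : ∀ i, i < n + 1 → ((α m₀).comp (α m₁).symm) (c' m₁ i) = c' m₀ i := by
      intro i hi
      have h₀ := congrFun (hα m₀) ⟨i, hi⟩
      have h₁ := congrFun (hα m₁) ⟨i, hi⟩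
      simp only [Function.comp_apply, hm₀', hm₁'] at h₀ h₁
      rw [FirstOrder.Language.Equiv.comp_apply, ← h₁, ← h₀,
        FirstOrder.Language.Equiv.symm_apply_apply]
    intro i hi
    rw [Function.comp_apply, heq i hi]
    rcases Nat.lt_succ_iff_lt_or_eq.1 hi with h | rfl
    · rw [Function.update_of_ne h.ne, hc'c m₀ i h]
    · rw [Function.update_self]
  choose next hnext using step
  let D : ∀ n, {c : ℕ → A // Good n c} := fun n => Nat.rec
    ⟨(hne 0).choose, fun m => (hne m).imp fun c h => ⟨h, by simp⟩⟩
    (fun n c => ⟨Function.update c.1 n (next n c.1 c.2), hnext n c.1 c.2⟩) n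
  have hD : ∀ n i, i ≠ n → (D (n + 1)).1 i = (D n).1 i := fun n i hi =>
    Function.update_of_ne hi _ _
  have hstab : ∀ n i, i < n → (D n).1 i = (D (i + 1)).1 i := by
    intro n i hin
    induction n, hin using Nat.le_induction with
    | base => rfl
    | succ n hn ih => rw [hD n i (by omega), ih]
  refine ⟨fun i => (D (i + 1)).1 i, fun n => ?_⟩
  obtain ⟨c', hc', h⟩ := (D n).2 n
  exact hlocal n c' _ (fun i hi => (h i hi).trans (hstab n i hi)) hc'

end Koenig

/-! ### Quantifier-free types -/

section QuantifierFree

variable {L : FirstOrder.Language.{u, v}} {A : Type w} [L.Structure A]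

variable (L) in
/-- The tuples `x` and `y` have the same quantifier-free type. -/
def SameQF {α : Type*} (x y : α → A) : Prop :=
  ∀ φ : L.Formula α, φ.IsQF → (φ.Realize x ↔ φ.Realize y)

theorem SameQF.symm {α : Type*} {x y : α → A} (h : SameQF L x y) : SameQF L y x :=
  fun φ hφ => (h φ hφ).symm

theorem SameQF.trans {α : Type*} {x y z : α → A} (h : SameQF L x y) (h' : SameQF L y z) :
    SameQF L x z :=
  fun φ hφ => (h φ hφ).trans (h' φ hφ)

theorem SameQF.comp {α β : Type*} {x y : α → A} (h : SameQF L x y) (g : β → α) :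
    SameQF L (x ∘ g) (y ∘ g) := by
  intro φ hφ
  rw [← Formula.realize_relabel, ← Formula.realize_relabel]
  exact h _ (hφ.relabel _)

theorem sameQF_embedding {α : Type*} (σ : A ↪[L] A) (x : α → A) : SameQF L x (σ ∘ x) := by
  intro φ hφ
  have := hφ.realize_embedding σ (v := x) (xs := default)
  rw [Subsingleton.elim (σ ∘ default) default] at this
  exact this.symm

theorem sameQF_equiv {α : Type*} (σ : A ≃[L] A) (x : α → A) : SameQF L x (σ ∘ x) :=
  sameQF_embedding σ.toEmbedding x

/-- A map that preserves quantifier-free types of finite tuples is an embedding. -/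
theorem exists_embedding_of_sameQF (ρ : A → A)
    (h : ∀ (n : ℕ) (x : Fin n → A), SameQF L x (ρ ∘ x)) : ∃ σ : A ↪[L] A, ⇑σ = ρ := by
  refine ⟨{ toFun := ρ, inj' := ?_, map_fun' := ?_, map_rel' := ?_ }, rfl⟩
  · intro x y hxy
    have := h 2 ![x, y] ((Term.var 0).equal (Term.var 1)) (BoundedFormula.IsAtomic.equal _ _).isQF
    simpa [Formula.realize_equal, hxy] using this
  · intro n F x
    have := h (n + 1) (Fin.snoc x (Structure.funMap F x))
      ((Term.func F fun i => Term.var i.castSucc).equal (Term.var (Fin.last n)))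
      (BoundedFormula.IsAtomic.equal _ _).isQF
    simp [Formula.realize_equal] at this
    exact this.symm
  · intro n R x
    have := h n x (R.formula Term.var) (BoundedFormula.IsAtomic.rel _ _).isQF
    simpa [Formula.realize_rel, Function.comp_def] using this.symm

/-- In an oligomorphic structure, finitely many quantifier-free formulas suffice to tell a
quantifier-free type from all others, so that a single one isolates it. -/
theorem IsOligomorphic.exists_isQF (hA : IsOligomorphic L A) {κ : Type*} [Finite κ] (x : κ → A) :
    ∃ φ : L.Formula κ, φ.IsQF ∧ ∀ z, φ.Realize z ↔ SameQF L x z := by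
  obtain ⟨F, hF, hrep⟩ := hA.of_finite_index κ
  have key : ∀ F : Set (κ → A), F.Finite → ∃ φ : L.Formula κ, φ.IsQF ∧ φ.Realize x ∧
      ∀ t ∈ F, φ.Realize t → SameQF L x t := by
    intro F hF
    induction F, hF using Set.Finite.induction_on with
    | empty => exact ⟨⊤, BoundedFormula.IsQF.top, by simp, by simp⟩
    | @insert t F _ _ ih =>
      obtain ⟨φ, hφ, hx, h⟩ := ih
      by_cases ht : SameQF L x t
      · refine ⟨φ, hφ, hx, fun t' ht' hr => ?_⟩
        rcases ht' with rfl | ht'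
        exacts [ht, h t' ht' hr]
      · obtain ⟨ψ, hψ, hψx, hψt⟩ : ∃ ψ : L.Formula κ, ψ.IsQF ∧ ψ.Realize x ∧ ¬ ψ.Realize t := by
          obtain ⟨ψ, hψ, h⟩ : ∃ ψ : L.Formula κ, ψ.IsQF ∧ ¬ (ψ.Realize x ↔ ψ.Realize t) := by
            simpa [SameQF] using ht
          by_cases hψx : ψ.Realize x
          · exact ⟨ψ, hψ, hψx, fun hψt => h (iff_of_true hψx hψt)⟩
          · exact ⟨ψ.not, hψ.not, hψx, fun hψt => h (iff_of_false hψx hψt)⟩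
        refine ⟨φ ⊓ ψ, hφ.inf hψ, Formula.realize_inf.2 ⟨hx, hψx⟩, fun t' ht' hr => ?_⟩
        rw [Formula.realize_inf] at hr
        rcases ht' with rfl | ht'
        exacts [(hψt hr.2).elim, h t' ht' hr.1]
  obtain ⟨φ, hφ, hx, h⟩ := key F hF
  refine ⟨φ, hφ, fun z => ⟨fun hz => ?_, fun hz => (hz φ hφ).1 hx⟩⟩
  obtain ⟨t, ht, α, rfl⟩ := hrep z
  exact (h t ht ((sameQF_equiv α t φ hφ).2 hz)).trans (sameQF_equiv α t)

theorem IsOligomorphic.exists_isQF_finite (hA : IsOligomorphic L A) {κ : Type*} [Finite κ]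
    {X : Set (κ → A)} (hX : X.Finite) :
    ∃ φ : L.Formula κ, φ.IsQF ∧ ∀ z, φ.Realize z ↔ ∃ x ∈ X, SameQF L x z := by
  induction X, hX using Set.Finite.induction_on with
  | empty => exact ⟨⊥, BoundedFormula.isQF_bot, by simp⟩
  | @insert x X _ _ ih =>
    obtain ⟨φ, hφ, h⟩ := ih
    obtain ⟨ψ, hψ, h'⟩ := hA.exists_isQF x
    exact ⟨ψ ⊔ φ, hψ.sup hφ, fun z => by simp [h, h']⟩

end QuantifierFree

/-! ### Invariant relations are existentially definable -/

section ExistentiallyDefinable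

variable {L : FirstOrder.Language.{u, v}} {A : Type w} [L.Structure A]

theorem isExistential_exs {α : Type*} {n : ℕ} {φ : L.BoundedFormula α n} (h : φ.IsExistential) :
    φ.exs.IsExistential := by
  induction n with
  | zero => exact h
  | succ n ih => exact ih h.ex

/-- If every finite part of the structure over `a` can be copied over `b`, then some self-embedding
takes `a` to `b`. -/
theorem IsOligomorphic.exists_embedding (hA : IsOligomorphic L A) {s : ℕ → A}
    (hs : Function.Surjective s) {ι : Type*} [Finite ι] {a b : ι → A}
    (h : ∀ n, ∃ c : ℕ → A, SameQF L (Sum.elim a fun i : Fin n => s i)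
      (Sum.elim b fun i : Fin n => c i)) : ∃ ρ : A ↪[L] A, ρ ∘ a = b := by
  obtain ⟨e, he⟩ := hA.exists_branch
    (fun n c => ∃ α : A ≃[L] A, SameQF L (Sum.elim a fun i : Fin n => s i)
      (Sum.elim b fun i : Fin n => α (c i)))
    (by
      rintro n c ⟨α, hα⟩
      refine ⟨α, ?_⟩
      convert hα.comp (Sum.map id Fin.castSucc) using 1 <;> · ext (i | i) <;> rfl)
    (by
      rintro n c c' hcc' ⟨α, hα⟩
      refine ⟨α, ?_⟩
      convert hα using 4 with i
      exact (hcc' i i.2).symm)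
    (by
      rintro n c β ⟨α, hα⟩
      refine ⟨α.comp β.symm, ?_⟩
      simpa using hα)
    (fun n => (h n).imp fun c hc => ⟨FirstOrder.Language.Equiv.refl L A, hc⟩)
  -- The branch `e` is determined only up to automorphisms; `α n` fits its first `n` entries to `b`.
  -- For `N` beyond the indices of the entries of `a`, the map `s i ↦ α N (e i)` takes `a` to `b`.
  choose α hα using he
  have hse : ∀ n, SameQF L (fun i : Fin n => s i) (fun i : Fin n => e i) := fun n =>
    ((hα n).comp Sum.inr).trans (sameQF_equiv (α n) _).symm
  obtain ⟨idx, hidx⟩ := hs.hasRightInverse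
  obtain ⟨N, hN⟩ : ∃ n, ∀ i, idx (a i) < n := by
    obtain ⟨m, hm⟩ := (finite_range fun i => idx (a i)).bddAbove
    exact ⟨m + 1, fun i => Nat.lt_succ_of_le (hm ⟨i, rfl⟩)⟩
  obtain ⟨ρ, hρ⟩ := exists_embedding_of_sameQF (L := L) (fun x => α N (e (idx x))) (by
    intro k x
    obtain ⟨m, hm⟩ := (finite_range fun i => idx (x i)).bddAbove
    have := ((hse (m + 1)).trans (sameQF_equiv (α N) _)).comp
      fun i : Fin k => ⟨idx (x i), Nat.lt_succ_of_le (hm ⟨i, rfl⟩)⟩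
    convert this using 1
    · ext i
      exact (hidx (x i)).symm
    · rfl)
  refine ⟨ρ, funext fun i => ?_⟩
  have := (hα N ((Term.var (Sum.inl i)).equal (Term.var (Sum.inr ⟨idx (a i), hN i⟩)))
    (BoundedFormula.IsAtomic.equal _ _).isQF).1 (by simp [Formula.realize_equal, hidx (a i)])
  rw [Formula.realize_equal] at this
  rw [hρ]
  exact this.symm

/-- Relations invariant under all self-embeddings are existentially definable. -/
theorem IsOligomorphic.existentiallyDefinable [Countable A] [Nonempty A]
    (hA : IsOligomorphic L A) {ι : Type} [Finite ι] {R : Set (ι → A)}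
    (hR : ∀ σ : A ↪[L] A, ∀ x ∈ R, σ ∘ x ∈ R) : ExistentiallyDefinable L R := by
  obtain ⟨s, hs⟩ := exists_surjective_nat A
  obtain ⟨F, hF, hrep⟩ := hA.of_finite_index ι
  have hR' : ∀ (α : A ≃[L] A) (x : ι → A), α ∘ x ∈ R → x ∈ R := by
    intro α x hx
    convert hR α.symm.toEmbedding _ hx using 1
    ext i
    exact (α.symm_apply_apply (x i)).symm
  -- Beyond some length `n`, the initial segment of the enumeration cannot be copied from a
  -- representative in `R` to a representative outside `R`.
  obtain ⟨n, hn⟩ : ∃ n, ∀ a ∈ F ∩ R, ∀ b ∈ F \ R, ∀ c : ℕ → A,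
      ¬ SameQF L (Sum.elim a fun i : Fin n => s i) (Sum.elim b fun i : Fin n => c i) := by
    have hpair : ∀ p : (F ∩ R : Set _) × (F \ R : Set _), ∃ n, ∀ c : ℕ → A,
        ¬ SameQF L (Sum.elim p.1.1 fun i : Fin n => s i) (Sum.elim p.2.1 fun i : Fin n => c i) := by
      rintro ⟨a, b⟩
      by_contra! h
      obtain ⟨ρ, hρ⟩ := hA.exists_embedding hs h
      exact b.2.2 (hρ ▸ hR ρ _ a.2.2)
    choose m hm using hpair
    have : Finite (F ∩ R : Set _) := hF.subset inter_subset_left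
    have : Finite (F \ R : Set _) := hF.subset sdiff_subset
    obtain ⟨n, hn⟩ := (finite_range m).bddAbove
    refine ⟨n, fun a ha b hb c hc => hm (⟨a, ha⟩, ⟨b, hb⟩) c ?_⟩
    convert hc.comp (Sum.map id (Fin.castLE (hn ⟨(⟨a, ha⟩, ⟨b, hb⟩), rfl⟩))) using 1 <;>
      · ext (i | i) <;> rfl
  obtain ⟨θ, hθ, hθr⟩ := hA.exists_isQF_finite
    ((hF.subset (inter_subset_left (t := R))).image fun a => Sum.elim a fun i : Fin n => s i)
  -- `θ` lists the quantifier-free types of the tuples `(a, s 0, …, s (n - 1))`, where `a` runs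
  -- through the representatives in `R`.
  refine ⟨θ.iExs (Fin n), isExistential_exs (hθ.relabel _).isExistential, ?_⟩
  ext x
  simp only [mem_ofPred_eq, Formula.realize_iExs, hθr, exists_mem_image]
  obtain ⟨t, ht, α, rfl⟩ := hrep x
  constructor
  · intro hx
    refine ⟨fun i => α (s i), t, ⟨ht, hR' α t hx⟩, ?_⟩
    convert sameQF_equiv α _ using 1
    ext (i | i) <;> rfl
  · rintro ⟨y, a, ha, hy⟩
    by_contra hx
    refine hn a ha t ⟨ht, fun h => hx (hR α.toEmbedding t h)⟩
      (fun i => if h : i < n then α.symm (y ⟨i, h⟩) else s 0) ?_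
    convert hy.trans (sameQF_equiv α.symm _) using 1
    ext (i | i)
    · exact (α.symm_apply_apply (t i)).symm
    · simp

end ExistentiallyDefinable

/-! ### Continuous homomorphisms -/

section Continuity

variable {L : FirstOrder.Language.{u, v}} {A : Type w} [L.Structure A]
  {L' : FirstOrder.Language.{u', v'}} {B : Type w'} [L'.Structure B]

theorem mem_nhds_embedding_iff {σ : A ↪[L] A} {O : Set (A ↪[L] A)} :
    O ∈ nhds σ ↔ ∃ F : Set A, F.Finite ∧ ∀ τ : A ↪[L] A, (∀ a ∈ F, τ a = σ a) → τ ∈ O := by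
  let _ : TopologicalSpace A := ⊥
  have : DiscreteTopology A := ⟨rfl⟩
  rw [nhds_induced, Filter.mem_comap]
  constructor
  · rintro ⟨V, hV, hVO⟩
    rw [nhds_pi, Filter.mem_pi] at hV
    obtain ⟨F, hF, t, ht, hsub⟩ := hV
    refine ⟨F, hF, fun τ hτ => hVO (hsub fun a ha => ?_)⟩
    change τ a ∈ t a
    exact hτ a ha ▸ mem_of_mem_nhds (ht a)
  · rintro ⟨F, hF, h⟩
    refine ⟨F.pi fun a => {σ a}, ?_, fun τ hτ => h τ hτ⟩
    exact set_pi_mem_nhds hF fun a _ => by simp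

/-- Continuity for the topologies of pointwise convergence: each value of `f σ` depends on only
finitely many values of `σ`. -/
theorem continuous_iff_exists_finite {f : (A ↪[L] A) → (B →[L'] B)} :
    Continuous f ↔ ∀ (σ : A ↪[L] A) (b : B), ∃ F : Set A, F.Finite ∧
      ∀ τ : A ↪[L] A, (∀ a ∈ F, τ a = σ a) → f τ b = f σ b := by
  let _ : TopologicalSpace B := ⊥
  have : DiscreteTopology B := ⟨rfl⟩
  rw [continuous_induced_rng, continuous_pi_iff]
  simp only [continuous_iff_continuousAt, ContinuousAt, nhds_discrete, Filter.tendsto_pure]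
  rw [forall_comm]
  exact forall₂_congr fun σ b => mem_nhds_embedding_iff

/-- The values of `f σ` at finitely many points depend only on a bounded part of `σ`, uniformly in
`σ`: modulo left multiplication by automorphisms, `Emb(A)` is compact. -/
theorem IsOligomorphic.exists_uniform (hA : IsOligomorphic L A) {s : ℕ → A}
    (hs : Function.Surjective s) (f : (A ↪[L] A) →* (B →[L'] B)) (hf : Continuous f)
    {F : Set B} (hF : F.Finite) : ∃ N, ∀ b ∈ F, ∀ σ τ : A ↪[L] A,
      (∀ i < N, σ (s i) = τ (s i)) → f σ b = f τ b := by
  have single : ∀ b, ∃ N, ∀ σ τ : A ↪[L] A, (∀ i < N, σ (s i) = τ (s i)) → f σ b = f τ b := by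
    intro b
    by_contra! hcon
    -- Otherwise pairs `σ`, `τ` violating the claim converge, modulo automorphisms, to some `ρ`, at
    -- which `f` is not continuous.
    obtain ⟨e, he⟩ := hA.exists_branch
      (fun n c => ∃ σ τ : A ↪[L] A, (∀ i < n, σ (s i) = c i ∧ τ (s i) = c i) ∧ f σ b ≠ f τ b)
      (fun n c ⟨σ, τ, h, hne⟩ => ⟨σ, τ, fun i hi => h i (by omega), hne⟩)
      (fun n c c' hcc' ⟨σ, τ, h, hne⟩ => ⟨σ, τ, fun i hi => hcc' i hi ▸ h i hi, hne⟩)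
      (by
        rintro n c α ⟨σ, τ, h, hne⟩
        refine ⟨α.toEmbedding * σ, α.toEmbedding * τ, fun i hi => ?_, fun heq => hne ?_⟩
        · exact ⟨congrArg α (h i hi).1, congrArg α (h i hi).2⟩
        · rw [map_mul, map_mul] at heq
          have hinv : f α.symm.toEmbedding * f α.toEmbedding = 1 := by
            rw [← map_mul, ← map_one f]
            congr 1
            exact FirstOrder.Language.Embedding.ext fun x => α.symm_apply_apply x
          have := congrArg (f α.symm.toEmbedding) heq
          change (f α.symm.toEmbedding * f α.toEmbedding) (f σ b) =
            (f α.symm.toEmbedding * f α.toEmbedding) (f τ b) at this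
          rwa [hinv] at this)
      (fun n => by
        obtain ⟨σ, τ, h, hne⟩ := hcon n
        exact ⟨fun i => σ (s i), σ, τ, fun i hi => ⟨rfl, (h i hi).symm⟩, hne⟩)
    obtain ⟨idx, hidx⟩ := hs.hasRightInverse
    have hbound : ∀ G : Set A, G.Finite → ∃ n, ∀ a ∈ G, idx a < n := by
      intro G hG
      obtain ⟨m, hm⟩ := (hG.image idx).bddAbove
      exact ⟨m + 1, fun a ha => Nat.lt_succ_of_le (hm ⟨a, ha, rfl⟩)⟩
    obtain ⟨ρ, hρ⟩ := exists_embedding_of_sameQF (L := L) (fun x => e (idx x)) (by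
      intro k x
      obtain ⟨n, hn⟩ := hbound (range x) (finite_range x)
      obtain ⟨σ, τ, h, -⟩ := he n
      convert sameQF_embedding σ x using 1
      ext i
      have := (h (idx (x i)) (hn _ ⟨i, rfl⟩)).1
      rw [hidx (x i)] at this
      exact this.symm)
    obtain ⟨G, hG, hGf⟩ := continuous_iff_exists_finite.1 hf ρ b
    obtain ⟨n, hn⟩ := hbound G hG
    obtain ⟨σ, τ, h, hne⟩ := he n
    refine hne ((hGf σ fun a ha => ?_).trans (hGf τ fun a ha => ?_).symm)
    · have := (h _ (hn a ha)).1
      rwa [hidx a, ← congrFun hρ a] at this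
    · have := (h _ (hn a ha)).2
      rwa [hidx a, ← congrFun hρ a] at this
  choose N hN using single
  obtain ⟨m, hm⟩ := (hF.image N).bddAbove
  exact ⟨m, fun b hb σ τ h => hN b σ τ fun i hi => h i (hi.trans_le (hm ⟨b, hb, rfl⟩))⟩

theorem CoveredByFinitelyManyOrbits.mono {S S' : Set (B →[L'] B)} (hSS' : S ⊆ S')
    (h : CoveredByFinitelyManyOrbits S) : CoveredByFinitelyManyOrbits S' := by
  obtain ⟨F, hF, hcov⟩ := h
  refine ⟨F, hF, eq_univ_of_univ_subset (hcov ▸ ?_)⟩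
  exact biUnion_mono Subset.rfl fun m _ x ⟨σ, hσ, hx⟩ => ⟨σ, hSS' hσ, hx⟩

theorem coveredByFinitelyManyOrbits_iff {S : Set (B →[L'] B)} :
    CoveredByFinitelyManyOrbits S ↔ ∃ F : Set B, F.Finite ∧ ∀ x, ∃ b ∈ F, ∃ σ ∈ S, σ b = x := by
  simp [CoveredByFinitelyManyOrbits, eq_univ_iff_forall, orbit]

/-- The orbit of `b` under `Emb(A)` splits into finitely many orbits under `Aut(A)`, since `f σ b`
is determined by the image under `σ` of one finite tuple. -/
theorem IsOligomorphic.covered_autSet [Countable A] [Nonempty A] (hA : IsOligomorphic L A)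
    (f : (A ↪[L] A) →* (B →[L'] B)) (hf : Continuous f)
    (h : CoveredByFinitelyManyOrbits (range f)) :
    CoveredByFinitelyManyOrbits (f '' autSet L A) := by
  obtain ⟨s, hs⟩ := exists_surjective_nat A
  rw [coveredByFinitelyManyOrbits_iff] at h ⊢
  obtain ⟨F, hF, hcov⟩ := h
  obtain ⟨N, hN⟩ := hA.exists_uniform hs f hf hF
  obtain ⟨T, hT, hrep⟩ := hA N
  have : ∀ t : Fin N → A, ∃ σ : A ↪[L] A,
      (∃ σ' : A ↪[L] A, ∀ i : Fin N, σ' (s i) = t i) → ∀ i : Fin N, σ (s i) = t i := fun t => by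
    by_cases ht : ∃ σ' : A ↪[L] A, ∀ i : Fin N, σ' (s i) = t i
    · exact ht.imp fun _ h _ => h
    · exact ⟨1, fun h => (ht h).elim⟩
  choose σ hσ using this
  refine ⟨image2 (fun t b => f (σ t) b) T F, hT.image2 _ hF, fun x => ?_⟩
  obtain ⟨b, hb, _, ⟨τ, rfl⟩, rfl⟩ := hcov x
  obtain ⟨t, ht, α, hα⟩ := hrep fun i => τ (s i)
  refine ⟨f (σ t) b, ⟨t, ht, b, hb, rfl⟩, f α.toEmbedding, ⟨_, ⟨α, rfl⟩, rfl⟩, ?_⟩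
  have hσt := hσ t ⟨α.symm.toEmbedding * τ, fun i => by
    change α.symm (τ (s i)) = t i
    rw [← congrFun hα i]
    exact α.symm_apply_apply (t i)⟩
  change (f α.toEmbedding * f (σ t)) b = f τ b
  rw [← map_mul]
  refine hN b hb _ _ fun i hi => ?_
  exact (congrArg α (hσt ⟨i, hi⟩)).trans (congrFun hα ⟨i, hi⟩)

end Continuity

/-! ### Interpretations and homomorphisms -/

section Interpretations

variable {L : FirstOrder.Language.{u, v}} {A : Type w} [L.Structure A]
  {L' : FirstOrder.Language.{u', v'}} {B : Type w'} [L'.Structure B]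

theorem ExistentiallyDefinable.comp_mem {α : Type} {X : Set (α → A)}
    (hX : ExistentiallyDefinable L X) (σ : A ↪[L] A) {x : α → A} (hx : x ∈ X) : σ ∘ x ∈ X := by
  obtain ⟨φ, hφ, rfl⟩ := hX
  have := hφ.realize_embedding σ (v := x) (xs := default) hx
  rwa [Subsingleton.elim (σ ∘ default) default] at this

theorem ExistentiallyDefinable.definable {α : Type} {X : Set (α → A)}
    (hX : ExistentiallyDefinable L X) : (∅ : Set A).Definable L X := by
  obtain ⟨φ, -, rfl⟩ := hX
  exact empty_definable_iff.2 ⟨φ, rfl⟩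

/-- Basic sets are invariant under endomorphisms. -/
theorem IsBasicSet.comp_mem {k : ℕ} {X : Set (Fin k → B)} (hX : IsBasicSet L' B X) (g : B →[L'] B)
    {x : Fin k → B} (hx : x ∈ X) : g ∘ x ∈ X := by
  cases hX with
  | univ => trivial
  | diagonal => exact congrArg g hx
  | relation R => exact g.map_rel R x hx
  | graph G =>
    have hx' : Structure.funMap G (fun j => x j.castSucc) = x (Fin.last _) := hx
    change Structure.funMap G (fun j => g (x j.castSucc)) = g (x (Fin.last _))
    rw [← hx', g.map_fun]
    rfl

/-- A continuous homomorphism from `Emb(A)` to `End(B)` induced by an existential interpretation: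
`f σ (i u) = i (σ u)`. -/
theorem Interpretation.IsExistential.exists_hom {i : Interpretation L A L' B}
    (hi : i.IsExistential) : ∃ f : (A ↪[L] A) →* (B →[L'] B), Continuous f ∧
      ∀ (σ : A ↪[L] A) (u u' : i.domain), u'.1 = σ ∘ u.1 → f σ (i.toFun u) = i.toFun u' := by
  have hbasic : ∀ {k : ℕ} {X : Set (Fin k → B)}, IsBasicSet L' B X → ∀ (σ : A ↪[L] A)
      (u : Fin k → i.domain), (fun j => i.toFun (u j)) ∈ X →
        ∃ h : ∀ j, σ ∘ (u j).1 ∈ i.domain, (fun j => i.toFun ⟨_, h j⟩) ∈ X := by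
    intro k X hX σ u hu
    exact (hi X hX).comp_mem σ (x := fun p => (u p.1).1 p.2) ⟨fun j => (u j).2, hu⟩
  have hdom : ∀ (σ : A ↪[L] A) (u : i.domain), σ ∘ u.1 ∈ i.domain := fun σ u =>
    (hbasic .univ σ (fun _ => u) trivial).1 0
  let act : (A ↪[L] A) → i.domain → i.domain := fun σ u => ⟨σ ∘ u.1, hdom σ u⟩
  have hact : ∀ {k : ℕ} {X : Set (Fin k → B)}, IsBasicSet L' B X → ∀ (σ : A ↪[L] A)
      (u : Fin k → i.domain), (fun j => i.toFun (u j)) ∈ X →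
        (fun j => i.toFun (act σ (u j))) ∈ X := fun hX σ u hu => (hbasic hX σ u hu).2
  obtain ⟨r, hr⟩ := i.surjective.hasRightInverse
  -- `i (σ u)` depends only on `i u`, because the preimage of the diagonal is preserved by `σ`.
  have hker : ∀ (σ : A ↪[L] A) (u : i.domain),
      i.toFun (act σ (r (i.toFun u))) = i.toFun (act σ u) := fun σ u =>
    hact .diagonal σ ![r (i.toFun u), u] (hr (i.toFun u))
  let f : (A ↪[L] A) → (B →[L'] B) := fun σ =>
    { toFun := fun b => i.toFun (act σ (r b))
      map_fun' := by
        intro n G x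
        have := hact (.graph G) σ (Fin.snoc (fun j => r (x j)) (r (Structure.funMap G x)))
          (by simp [hr _])
        simpa [Function.comp_def] using this.symm
      map_rel' := by
        intro n R x hx
        exact hact (.relation R) σ (fun j => r (x j)) (by simpa [hr _] using hx) }
  refine ⟨{ toFun := f, map_one' := ?_, map_mul' := ?_ }, ?_, ?_⟩
  · exact FirstOrder.Language.Hom.ext fun b => hr b
  · exact fun σ τ => FirstOrder.Language.Hom.ext fun b => (hker σ (act τ (r b))).symm
  · refine continuous_iff_exists_finite.2 fun σ b => ⟨range (r b).1, finite_range _, fun τ h => ?_⟩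
    refine congrArg i.toFun (Subtype.ext (funext fun j => ?_))
    exact h _ ⟨j, rfl⟩
  · rintro σ u ⟨_, h⟩ rfl
    exact hker σ u

/-- The homomorphism induced by an existential interpretation covers `B` by finitely many orbits of
`Aut(A)` alone, since every element of `B` is the image of a tuple conjugate to one of finitely many. -/
theorem Interpretation.IsExistential.exists_covered (hA : IsOligomorphic L A)
    {i : Interpretation L A L' B} (hi : i.IsExistential) :
    ∃ f : (A ↪[L] A) →* (B →[L'] B), Continuous f ∧
      CoveredByFinitelyManyOrbits (f '' autSet L A) := by
  obtain ⟨f, hf, hfi⟩ := hi.exists_hom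
  refine ⟨f, hf, coveredByFinitelyManyOrbits_iff.2 ?_⟩
  obtain ⟨T, hT, hrep⟩ := hA i.dim
  refine ⟨i.toFun '' (Subtype.val ⁻¹' T), (hT.preimage Subtype.val_injective.injOn).image _,
    fun x => ?_⟩
  obtain ⟨u, rfl⟩ := i.surjective x
  obtain ⟨t, ht, α, hα⟩ := hrep u.1
  have hu : t = α.symm.toEmbedding ∘ u.1 := by
    rw [← hα]
    ext j
    exact (α.symm_apply_apply (t j)).symm
  have htU : t ∈ i.domain := by
    have h := (hi _ .univ).comp_mem α.symm.toEmbedding (x := fun p => u.1 p.2)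
      ⟨fun _ => u.2, trivial⟩
    rw [hu]
    exact h.1 0
  exact ⟨_, ⟨⟨t, htU⟩, ht, rfl⟩, _, ⟨_, ⟨α, rfl⟩, rfl⟩, hfi _ _ _ hα.symm⟩

/-- A surjection onto `B` that is equivariant with respect to `f` is an existential
interpretation. -/
theorem IsOligomorphic.existentiallyInterpretable_of_equivariant [Countable A] [Nonempty A]
    (hA : IsOligomorphic L A) (f : (A ↪[L] A) → (B →[L'] B)) {n : ℕ} {U : Set (Fin n → A)}
    (i : U → B) (hi : Function.Surjective i)
    (hequiv : ∀ (σ : A ↪[L] A) (u : U), ∃ h : σ ∘ u.1 ∈ U, i ⟨σ ∘ u.1, h⟩ = f σ (i u)) :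
    ExistentiallyInterpretable L A L' B := by
  have hex : ∀ {k : ℕ} (X : Set (Fin k → B)), IsBasicSet L' B X →
      ExistentiallyDefinable L (tuplePreimage i X) := by
    intro k X hX
    refine hA.existentiallyDefinable ?_
    rintro σ x ⟨h, hx⟩
    choose h' hi' using fun j => hequiv σ ⟨_, h j⟩
    refine ⟨h', ?_⟩
    convert hX.comp_mem (f σ) hx using 1
    exact funext hi'
  exact ⟨⟨n, U, i, hi, fun X hX => (hex X hX).definable⟩, hex⟩

/-- Let finitely many orbits of points `b ∈ F` cover `B`, and let the finite tuple `s` determine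
the values of `f σ` on `F`. Then `σ (s, y_b) ↦ f σ b` is the required interpretation, where the
tuple `y_b`, indexed by `Option F` and composed of two distinct elements `p` and `q`, serves to tell
the points of `F` apart. -/
theorem IsOligomorphic.existentiallyInterpretable [Countable A] [Nontrivial A]
    (hA : IsOligomorphic L A) (f : (A ↪[L] A) →* (B →[L'] B)) (hf : Continuous f)
    (h : CoveredByFinitelyManyOrbits (range f)) : ExistentiallyInterpretable L A L' B := by
  classical
  obtain ⟨s, hs⟩ := exists_surjective_nat A
  obtain ⟨F, hF, hcov⟩ := coveredByFinitelyManyOrbits_iff.1 h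
  obtain ⟨N, hN⟩ := hA.exists_uniform hs f hf hF
  obtain ⟨p, q, hpq⟩ := exists_pair_ne A
  have : Finite F := hF
  obtain ⟨n, ⟨e⟩⟩ := Finite.exists_equiv_fin (Fin N ⊕ Option F)
  let t : F → Fin n → A := fun b =>
    Sum.elim (fun j : Fin N => s j) (fun b' => if b' = some b then p else q) ∘ e.symm
  have ht : ∀ (σ τ : A ↪[L] A) (b b' : F), σ ∘ t b = τ ∘ t b' → f σ b = f τ b' := by
    intro σ τ b b' heq
    have hval : ∀ y, σ (t b (e y)) = τ (t b' (e y)) := fun y => congrFun heq (e y)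
    have hs' : ∀ j < N, σ (s j) = τ (s j) := fun j hj => by
      simpa [t] using hval (Sum.inl ⟨j, hj⟩)
    obtain rfl : b = b' := by
      by_contra hne
      -- The coordinate `none` gives `σ q = τ q`, the coordinate of `b` gives `σ p = τ q`.
      have hq : σ q = τ q := by simpa [t] using hval (Sum.inr none)
      have hp : σ p = τ q := by simpa [t, hne] using hval (Sum.inr (some b))
      exact hpq (σ.injective (hp.trans hq.symm))
    exact hN b b.2 σ τ hs'
  let U : Set (Fin n → A) := {x | ∃ (b : F) (σ : A ↪[L] A), σ ∘ t b = x}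
  choose β ρ hβρ using fun x : U => x.2
  have hval : ∀ (σ : A ↪[L] A) (b : F) (h : σ ∘ t b ∈ U), f (ρ ⟨_, h⟩) (β ⟨_, h⟩) = f σ b :=
    fun σ b h => ht _ _ _ _ (hβρ ⟨_, h⟩)
  refine hA.existentiallyInterpretable_of_equivariant f (U := U) (fun x => f (ρ x) (β x)) ?_ ?_
  · intro x
    obtain ⟨b, hb, _, ⟨σ, rfl⟩, rfl⟩ := hcov x
    exact ⟨⟨σ ∘ t ⟨b, hb⟩, _, σ, rfl⟩, hval _ _ _⟩
  · rintro σ ⟨_, b, τ, rfl⟩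
    refine ⟨⟨b, σ * τ, rfl⟩, ?_⟩
    rw [hval τ b]
    refine (hval (σ * τ) b ⟨b, σ * τ, rfl⟩).trans ?_
    rw [map_mul]
    rfl

end Interpretations

end AlephZeroInterp

theorem mainTheorem1
    (L : FirstOrder.Language.{u, v}) (hL : AlephZeroInterp.CountableWithoutFunctions L)
    (L' : FirstOrder.Language.{u', v'}) (hL' : AlephZeroInterp.CountableWithoutFunctions L')
    (A : Type w) [L.Structure A] (B : Type w') [L'.Structure B]
    (hA : AlephZeroInterp.IsAlephZeroCategorical L A) (hA2 : Nontrivial A) :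
    (AlephZeroInterp.ExistentiallyInterpretable L A L' B ↔
      ∃ f : (A ↪[L] A) →* (B →[L'] B), Continuous f ∧
        AlephZeroInterp.CoveredByFinitelyManyOrbits (Set.range f)) ∧
    (AlephZeroInterp.ExistentiallyInterpretable L A L' B ↔
      ∃ f : (A ↪[L] A) →* (B →[L'] B), Continuous f ∧
        AlephZeroInterp.CoveredByFinitelyManyOrbits (f '' AlephZeroInterp.autSet L A)) ∧
    (∀ f : (A ↪[L] A) →* (B →[L'] B), Continuous f →
      (AlephZeroInterp.CoveredByFinitelyManyOrbits (Set.range f) ↔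
        AlephZeroInterp.CoveredByFinitelyManyOrbits (f '' AlephZeroInterp.autSet L A))) := by
  have : Countable L.Symbols := hL.1
  have : Countable A := hA.elim (fun _ => Finite.to_countable) And.left
  have hO : AlephZeroInterp.IsOligomorphic L A := hA.isOligomorphic
  have key : ∀ f : (A ↪[L] A) →* (B →[L'] B), Continuous f →
      (AlephZeroInterp.CoveredByFinitelyManyOrbits (Set.range f) ↔
        AlephZeroInterp.CoveredByFinitelyManyOrbits (f '' AlephZeroInterp.autSet L A)) :=
    fun f hf => ⟨hO.covered_autSet f hf, fun h => h.mono (Set.image_subset_range _ _)⟩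
  have h13 : AlephZeroInterp.ExistentiallyInterpretable L A L' B →
      ∃ f : (A ↪[L] A) →* (B →[L'] B), Continuous f ∧
        AlephZeroInterp.CoveredByFinitelyManyOrbits (f '' AlephZeroInterp.autSet L A) :=
    fun ⟨_, hi⟩ => hi.exists_covered hO
  refine ⟨⟨fun h => ?_, fun ⟨f, hf, h⟩ => hO.existentiallyInterpretable f hf h⟩,
    ⟨h13, fun ⟨f, hf, h⟩ => hO.existentiallyInterpretable f hf ((key f hf).2 h)⟩, key⟩
  obtain ⟨f, hf, h⟩ := h13 h
  exact ⟨f, hf, (key f hf).2 h⟩
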